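/- Let $k$ be an algebraically closed field of arbitrary characteristic, let $n,r$ be positive integers, $N=2n$, and let $d=(d_1,\dots,d_N)$ be an $N$-tuple of integers with $d_1\ge d_2\ge\dots\ge d_N$. Let $U_N$ be the affine space of strictly upper triangular $N\times N$ matrices over $k$, on which $\lambda\in k^*$ acts by $\lambda\cdot(x_{ij})=(\lambda^{d_i-d_j+1}x_{ij})$, and let $U(d)=(U_N\setminus\{0\})/k^*$ be the corresponding weighted projective space. Let $V(d)\subseteq U(d)$ be the set of classes of matrices $X$ with $X^2=0$, and let $L(d)\subseteq V(d)$ be the set of classes of those of rank less than $n$. For integers $1\le R,C\le N$ let $V(d)_{RC}\subseteq V(d)$ be the set of classes of matrices with $x_{ij}=0$ whenever $i\ge N-R+1$ or $j\le C$. For a subset $U\subseteq U(d)$, a map $\psi:\mathbb P^{r-1}_k\to U$ is called a nonconstant morphism if there are a positive integer $m$ and polynomials $\psi_{ij}\in k[x_1,\dots,x_r]$ $(1\le i<j\le N)$ such that each $\psi_{ij}$ is homogeneous of degree $m(d_i-d_j+1)$, the $\psi_{ij}$ have no common zero in $\mathbb P^{r-1}_k$, and for every $\gamma\in\mathbb P^{r-1}_k$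 the point $\psi(\gamma)$ is the class of the strictly upper triangular matrix with entries $\psi_{ij}(\gamma)$. Theorem. If $N<8$ and there exists a nonconstant morphism $\psi:\mathbb P^{r-1}_k\to V(d)_{RC}\setminus L(d)$, then $N\ge 2^{r-1}(R+C)$. -/

import Mathlib

namespace SquareZero

/-- `λ · (x_{ij}) = (λ ^ (d_i - d_j + 1) x_{ij})` for `λ ∈ k^*`. -/
def scale {k : Type*} [Field k] {N : ℕ} (d : Fin N → ℤ) (c : kˣ)
    (X : Matrix (Fin N) (Fin N) k) : Matrix (Fin N) (Fin N) k :=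
  Matrix.of fun i j => ((c ^ (d i - d j + 1) : kˣ) : k) * X i j

/-- `U_N - {0}`: the nonzero strictly upper triangular `N × N` matrices over `k`. -/
def PuncturedU (k : Type*) [Field k] (N : ℕ) : Type _ :=
  {X : Matrix (Fin N) (Fin N) k // (∀ i j, j ≤ i → X i j = 0) ∧ X ≠ 0}

/-- Two nonzero strictly upper triangular matrices are equivalent when they lie in one orbit of
the weighted action of `k^*`. -/
def weightedSetoid (k : Type*) [Field k] {N : ℕ} (d : Fin N → ℤ) : Setoid (PuncturedU k N) where
  r X Y := ∃ c : kˣ, scale d c X.1 = Y.1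
  iseqv :=
    { refl := fun X => ⟨1, by ext i j; simp [scale]⟩
      symm := by
        rintro X Y ⟨c, h⟩
        refine ⟨c⁻¹, ?_⟩
        rw [← h]
        ext i j
        simp only [scale, Matrix.of_apply]
        rw [← mul_assoc, ← Units.val_mul, ← mul_zpow]
        simp
      trans := by
        rintro X Y Z ⟨c, h⟩ ⟨c', h'⟩
        refine ⟨c' * c, ?_⟩
        rw [← h', ← h]
        ext i j
        simp only [scale, Matrix.of_apply]
        rw [← mul_assoc, ← Units.val_mul, ← mul_zpow] }

/-- The weighted projective space `U(d)`, the quotient of `U_N - {0}` by the action of `k^*`. -/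
def WeightedU (k : Type*) [Field k] {N : ℕ} (d : Fin N → ℤ) : Type _ :=
  Quotient (weightedSetoid k d)

/-- The quotient map `U_N - {0} → U(d)`. -/
def toWeightedU {k : Type*} [Field k] {N : ℕ} (d : Fin N → ℤ) (X : PuncturedU k N) :
    WeightedU k d :=
  Quotient.mk (weightedSetoid k d) X

/-- `V(d)`: the points of `U(d)` represented by square-zero matrices. -/
def V (k : Type*) [Field k] {N : ℕ} (d : Fin N → ℤ) : Set (WeightedU k d) :=
  toWeightedU d '' {X | X.1 * X.1 = 0}

/-- `L(d)`: the points of `V(d)` represented by matrices of rank less than `n`, where the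
matrices have size `N = 2 n`. -/
def L (k : Type*) [Field k] {n : ℕ} (d : Fin (2 * n) → ℤ) : Set (WeightedU k d) :=
  toWeightedU d '' {X | X.1 * X.1 = 0 ∧ X.1.rank < n}

/-- `V(d)_{RC}`: the points of `V(d)` represented by square-zero matrices whose last `R` rows and
first `C` columns vanish. In terms of 1-based indices, `x_{ij} = 0` whenever `i ≥ N - R + 1` or
`j ≤ C`; here `i` and `j` are 0-based. -/
def VRC (k : Type*) [Field k] {N : ℕ} (d : Fin N → ℤ) (R C : ℕ) : Set (WeightedU k d) :=
  toWeightedU d '' {X | X.1 * X.1 = 0 ∧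
    ∀ i j : Fin N, (N ≤ (i : ℕ) + R ∨ (j : ℕ) < C) → X.1 i j = 0}

/-- The strictly upper triangular matrix with entries `P i j`, `i < j`, evaluated at `x`. -/
noncomputable def evalUpper {k : Type*} [Field k] {N r : ℕ}
    (P : Fin N → Fin N → MvPolynomial (Fin r) k) (x : Fin r → k) : Matrix (Fin N) (Fin N) k :=
  Matrix.of fun i j => if i < j then MvPolynomial.eval x (P i j) else 0

/-- `ψ : ℙ^{r-1} → U`, with `U` a subset of the weighted projective space `U(d)`, is a
*nonconstant morphism*: it is represented by polynomials `ψ_{ij}`, `i < j`, in `r` variables such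
that for some positive integer `m` each `ψ_{ij}` is homogeneous of degree `m (d_i - d_j + 1)`, and
the `ψ_{ij}` have no common zero on `ℙ^{r-1}`. (For nonincreasing `d` and `i < j` the integer
`m (d_i - d_j + 1)` is positive, so `Int.toNat` only changes its type.) -/
def IsNonconstantMorphism {k : Type*} [Field k] {N r : ℕ} {d : Fin N → ℤ}
    {U : Set (WeightedU k d)} (ψ : Projectivization k (Fin r → k) → U) : Prop :=
  ∃ m : ℕ, 0 < m ∧ ∃ P : Fin N → Fin N → MvPolynomial (Fin r) k,
    (∀ i j, i < j → (P i j).IsHomogeneous ((m : ℤ) * (d i - d j + 1)).toNat) ∧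
    (∀ x : Fin r → k, x ≠ 0 → ∃ i j, i < j ∧ MvPolynomial.eval x (P i j) ≠ 0) ∧
    ∀ (x : Fin r → k) (hx : x ≠ 0), ∃ X : PuncturedU k N,
      X.1 = evalUpper P x ∧ (ψ (Projectivization.mk k x hx) : WeightedU k d) = toWeightedU d X

end SquareZero

/-! The `ψ_{ij}` form a strictly upper triangular matrix `X` over `S = k[x_1, …, x_r]`. Its entries
have no constant term, `X ^ 2 = 0`, and the rank is at least `n` away from the origin
(`IsSquareZeroFamily`). The bound follows by finding nonzero points where the rank would drop. The
source of such points is Krull's height theorem: fewer than `r` polynomials without constant terms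
have a common zero besides the origin (`exists_ne_zero_common_zero`).

For `r = 1`, counting nonzero rows and columns suffices. For `r ≥ 2`, a zero of the determinant of
the upper right block gives `R, C < n` (`not_rows_eq_zero`, `not_cols_eq_zero`). A zero of a `3 × 3`
determinant through which `X` factors excludes `n = 3`, `R = C = 2`
(`not_two_rows_and_cols_eq_zero`).

Since `n ≤ 3`, it remains to exclude `r ≥ 3` for `n = 2, 3`. Here `S` being factorial allows
singular `2 × 2` blocks to be factored. The hard case, `X 0 1 ≠ 0` and `X 4 5 = 0`, yields a complex
`S² → S³ → S`. By a depth argument it cannot be exact off the origin in three or more variables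
(`exists_not_exact`). -/

namespace MvPolynomial

/-! ### The ideal of the origin has height at least `r` -/

section Height

variable {k : Type*} [Field k] {r : ℕ}

/-- The substitution setting the variables of index less than `j` to zero. -/
noncomputable def killBelow (k : Type*) [Field k] {r : ℕ} (j : ℕ) :
    MvPolynomial (Fin r) k →ₐ[k] MvPolynomial (Fin r) k :=
  aeval fun i => if (i : ℕ) < j then 0 else X i

lemma killBelow_comp {j l : ℕ} (h : j ≤ l) (p : MvPolynomial (Fin r) k) :
    killBelow k l (killBelow k j p) = killBelow k l p := by
  suffices (killBelow k l).comp (killBelow k j) = killBelow k (r := r) l from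
    DFunLike.congr_fun this p
  ext1 i
  simp only [killBelow, AlgHom.comp_apply, aeval_X]
  split_ifs <;> first | omega | simp_all

instance (j : ℕ) : (RingHom.ker (killBelow k (r := r) j)).IsPrime := RingHom.ker_isPrime _

lemma ker_killBelow_lt (j : Fin r) :
    RingHom.ker (killBelow k (r := r) j) < RingHom.ker (killBelow k (r := r) (j + 1)) := by
  refine lt_of_le_of_ne (fun p hp => ?_) fun h => ?_
  · rw [RingHom.mem_ker] at hp ⊢
    rw [← killBelow_comp (Nat.le_succ j), hp, map_zero]
  · have : (X j : MvPolynomial (Fin r) k) ∈ RingHom.ker (killBelow k (r := r) (j + 1)) := by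
      simp [RingHom.mem_ker, killBelow]
    rw [← h] at this
    simp [RingHom.mem_ker, killBelow] at this

lemma le_height_ker_killBelow (j : ℕ) (hj : j ≤ r) :
    (j : ℕ∞) ≤ (RingHom.ker (killBelow k (r := r) j)).height := by
  induction j with
  | zero => simp
  | succ j ih =>
    have h := Ideal.height_add_one_le_of_lt_of_isPrime (ker_killBelow_lt (k := k) ⟨j, hj⟩)
    push_cast
    exact le_trans (add_le_add_left (ih (by omega)) 1) h

/-- The kernels of the successive substitutions `killBelow` form a strict chain of `r + 1` primes
inside this ideal. -/
lemma le_height_vanishingIdeal_zero :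
    (r : ℕ∞) ≤ (vanishingIdeal k ({0} : Set (Fin r → k))).height := by
  refine (le_height_ker_killBelow (k := k) r le_rfl).trans (Ideal.height_mono fun p hp => ?_)
  rw [RingHom.mem_ker] at hp
  rw [mem_vanishingIdeal_singleton_iff]
  have h : (aeval (0 : Fin r → k)).comp (killBelow k r) = aeval (0 : Fin r → k) := by
    ext1 i
    simp [killBelow]
  rw [← h, AlgHom.comp_apply, hp, map_zero]

end Height

/-! ### Nontrivial common zeros of few polynomials -/

section Zeros

variable {k : Type*} [Field k] {r : ℕ}

lemma span_ne_top_of_constantCoeff_eq_zero (s : Set (MvPolynomial (Fin r) k))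
    (h : ∀ p ∈ s, constantCoeff p = 0) : Ideal.span s ≠ ⊤ := by
  intro htop
  have : Ideal.span s ≤ RingHom.ker (constantCoeff (σ := Fin r) (R := k)) := Ideal.span_le.2 h
  rw [htop] at this
  simpa [RingHom.mem_ker] using this (Submodule.mem_top (x := 1))

variable [IsAlgClosed k]

/-- Fewer than `r` polynomials in `r` variables which generate a proper ideal have a common zero
other than the origin. -/
lemma exists_ne_zero_common_zero (s : Finset (MvPolynomial (Fin r) k)) (hs : s.card < r)
    (htop : Ideal.span (s : Set (MvPolynomial (Fin r) k)) ≠ ⊤) :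
    ∃ x : Fin r → k, x ≠ 0 ∧ ∀ p ∈ s, eval x p = 0 := by
  by_contra! hcon
  set I := Ideal.span (s : Set (MvPolynomial (Fin r) k)) with hI
  have hsub : zeroLocus k I ⊆ {0} := by
    intro x hx
    by_contra hx0
    obtain ⟨p, hp, hpx⟩ := hcon x hx0
    exact hpx (by simpa using hx p (Ideal.subset_span hp))
  have hle : vanishingIdeal k ({0} : Set (Fin r → k)) ≤ I.radical := by
    rw [← vanishingIdeal_zeroLocus_eq_radical (K := k)]
    exact vanishingIdeal_anti_mono hsub
  have h1 : I.radical.height ≤ I.height := by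
    rw [Ideal.height_eq_inf_minimalPrimes, Ideal.height_eq_inf_minimalPrimes (I := I),
      Ideal.radical_minimalPrimes]
  have h2 : I.height ≤ (s.card : ℕ∞) := by
    refine (Ideal.height_le_spanFinrank I htop).trans ?_
    refine (Submodule.spanFinrank_span_le_encard _).trans ?_
    simp
  have h3 := (le_height_vanishingIdeal_zero (k := k) (r := r)).trans
    ((Ideal.height_mono hle).trans (h1.trans h2))
  exact absurd (by exact_mod_cast h3) (not_le.mpr hs)

lemma exists_zero_of_constantCoeff_eq_zero (hr : 2 ≤ r) {p : MvPolynomial (Fin r) k}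
    (hp : constantCoeff p = 0) : ∃ x : Fin r → k, x ≠ 0 ∧ eval x p = 0 := by
  obtain ⟨x, hx, h⟩ := exists_ne_zero_common_zero {p} (by rw [Finset.card_singleton]; omega)
    (span_ne_top_of_constantCoeff_eq_zero _ (by simpa using hp))
  exact ⟨x, hx, h p (by simp)⟩

lemma exists_common_zero_of_constantCoeff_eq_zero (hr : 3 ≤ r) {p q : MvPolynomial (Fin r) k}
    (hp : constantCoeff p = 0) (hq : constantCoeff q = 0) :
    ∃ x : Fin r → k, x ≠ 0 ∧ eval x p = 0 ∧ eval x q = 0 := by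
  classical
  obtain ⟨x, hx, h⟩ := exists_ne_zero_common_zero {p, q} (Finset.card_le_two.trans_lt hr)
    (span_ne_top_of_constantCoeff_eq_zero _ (by simp [hp, hq]))
  exact ⟨x, hx, h p (by simp), h q (by simp)⟩

lemma isUnit_of_no_zero (hr : 2 ≤ r) {p : MvPolynomial (Fin r) k}
    (hp : ∀ x : Fin r → k, x ≠ 0 → eval x p ≠ 0) : IsUnit p := by
  by_contra hu
  obtain ⟨x, hx, h⟩ := exists_ne_zero_common_zero {p} (by rw [Finset.card_singleton]; omega)
    (by simpa [Ideal.span_singleton_eq_top] using hu)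
  exact hp x hx (h p (by simp))

end Zeros

end MvPolynomial

/-! ### Divisibility over a factorial domain -/

section Factorization

variable {S : Type*} [CommRing S] [UniqueFactorizationMonoid S]

lemma exists_eq_mul_isRelPrime (a b : S) :
    ∃ g v w : S, a = g * v ∧ b = g * w ∧ IsRelPrime v w := by
  by_cases hb : b = 0
  · exact ⟨a, 1, 0, by simp, by simp [hb], isRelPrime_one_left⟩
  · obtain ⟨v, w, g, h, rfl, rfl⟩ := UniqueFactorizationMonoid.exists_reduced_factors' a b hb
    exact ⟨g, v, w, rfl, rfl, h⟩

variable [IsDomain S]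

lemma IsRelPrime.exists_of_mul_add_mul_eq_zero {v w e f : S} (h : IsRelPrime v w)
    (he : v * e + w * f = 0) : ∃ z, e = w * z ∧ f = -v * z := by
  by_cases hw : w = 0
  · subst hw
    have hv : IsUnit v := h dvd_rfl (dvd_zero _)
    obtain ⟨u, rfl⟩ := hv
    refine ⟨-(↑u⁻¹ * f), ?_, by simp [← mul_assoc]⟩
    simpa using he
  · have hd : w ∣ v * e := ⟨-f, by linear_combination he⟩
    obtain ⟨z, rfl⟩ := h.symm.dvd_of_dvd_mul_left hd
    refine ⟨z, rfl, mul_left_cancel₀ hw ?_⟩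
    linear_combination he

/-- A singular `2 × 2` matrix over a factorial domain is the product of a column and a primitive
row. -/
lemma exists_rank_one_factorization {a b c d : S} (h : a * d = b * c) :
    ∃ u₁ u₂ v w : S, IsRelPrime v w ∧ a = u₁ * v ∧ b = u₁ * w ∧ c = u₂ * v ∧ d = u₂ * w := by
  by_cases hab : a = 0 ∧ b = 0
  · obtain ⟨g, v, w, hc, hd, hvw⟩ := exists_eq_mul_isRelPrime c d
    exact ⟨0, g, v, w, hvw, by simp [hab.1], by simp [hab.2], hc, hd⟩
  · obtain ⟨g, v, w, rfl, rfl, hvw⟩ := exists_eq_mul_isRelPrime a b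
    have hg : g ≠ 0 := by rintro rfl; simp at hab
    obtain ⟨z, hd, hc⟩ := hvw.exists_of_mul_add_mul_eq_zero (e := d) (f := -c)
      (mul_left_cancel₀ hg (by linear_combination h))
    exact ⟨g, z, v, w, hvw, rfl, rfl, by linear_combination -hc, by linear_combination hd⟩

end Factorization

/-- If `μ` has no nontrivial common divisor and `a` divides every `μ i * t`, then `a` divides
`t`. -/
lemma dvd_of_forall_dvd_mul {S : Type*} [CommRing S] [IsDomain S] [UniqueFactorizationMonoid S]
    {ι : Type*} [Fintype ι] {μ : ι → S} (hμ : ∀ g, (∀ i, g ∣ μ i) → IsUnit g) {a t : S}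
    (h : ∀ i, a ∣ μ i * t) : a ∣ t := by
  classical
  let _ : NormalizationMonoid S :=
    UniqueFactorizationMonoid.strongNormalizationMonoid.toNormalizationMonoid
  let _ : NormalizedGCDMonoid S := UniqueFactorizationMonoid.toNormalizedGCDMonoid S
  have h1 : a ∣ Finset.univ.gcd fun i => μ i * t := Finset.dvd_gcd fun i _ => h i
  have h2 : IsUnit (Finset.univ.gcd μ) := hμ _ fun i => Finset.gcd_dvd (Finset.mem_univ i)
  exact (h1.trans (Finset.gcd_mul_right' _ _ t).dvd).trans ((h2.dvd_mul_left).1 dvd_rfl)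

open MvPolynomial

/-! ### Cramer's rule for a primitive pair of columns -/

section Cramer

variable {S : Type*} [CommRing S] [IsDomain S] [UniqueFactorizationMonoid S]

/-- The `2 × 2` minors of a `3 × 2` matrix with columns `p`, `q`, up to sign: the cross product of
the columns. If they have no common divisor, a vector orthogonal to `v` is a combination of the
columns, for every nonzero `v` orthogonal to both columns. -/
lemma exists_eq_combination_of_orthogonal {p q v w : Fin 3 → S} (hv : v ≠ 0)
    (hvp : v ⬝ᵥ p = 0) (hvq : v ⬝ᵥ q = 0) (hvw : v ⬝ᵥ w = 0)
    (hμ : ∀ g, (∀ i, g ∣ (crossProduct p q) i) → IsUnit g) (hne : crossProduct p q ≠ 0) :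
    ∃ a b : S, w = a • p + b • q := by
  -- All of `p`, `q`, `w` are orthogonal to `v ≠ 0`, so their determinant vanishes.
  have hdet : w ⬝ᵥ crossProduct p q = 0 := by
    obtain ⟨i, hi⟩ := Function.ne_iff.1 hv
    refine (mul_eq_zero.1 (?_ : v i * _ = 0)).resolve_left hi
    simp only [dotProduct, Fin.sum_univ_three, cross_apply, Matrix.cons_val_zero,
      Matrix.cons_val_one, Matrix.cons_val] at hvp hvq hvw ⊢
    fin_cases i
    · simp only [Fin.zero_eta]
      linear_combination (p 1 * q 2 - p 2 * q 1) * hvw - (w 1 * q 2 - w 2 * q 1) * hvp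
        + (w 1 * p 2 - w 2 * p 1) * hvq
    · simp only [Fin.mk_one]
      linear_combination (p 2 * q 0 - p 0 * q 2) * hvw - (w 2 * q 0 - w 0 * q 2) * hvp
        + (w 2 * p 0 - w 0 * p 2) * hvq
    · simp only [Fin.reduceFinMk]
      linear_combination (p 0 * q 1 - p 1 * q 0) * hvw - (w 0 * q 1 - w 1 * q 0) * hvp
        + (w 0 * p 1 - w 1 * p 0) * hvq
  set μ := crossProduct p q with hμdef
  have h0 : ∀ i, μ i = ![p 1 * q 2 - p 2 * q 1, p 2 * q 0 - p 0 * q 2,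
    p 0 * q 1 - p 1 * q 0] i := fun i => by rw [hμdef, cross_apply]
  have hα : ∀ i, (crossProduct w q) i = ![w 1 * q 2 - w 2 * q 1, w 2 * q 0 - w 0 * q 2,
    w 0 * q 1 - w 1 * q 0] i := fun i => by rw [cross_apply]
  have hβ : ∀ i, (crossProduct p w) i = ![p 1 * w 2 - p 2 * w 1, p 2 * w 0 - p 0 * w 2,
    p 0 * w 1 - p 1 * w 0] i := fun i => by rw [cross_apply]
  rw [dotProduct, Fin.sum_univ_three, h0, h0, h0] at hdet
  simp only [Matrix.cons_val_zero, Matrix.cons_val_one,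
    Matrix.cons_val] at hdet
  -- The Cramer numerators `w × q` and `p × w` are proportional to `μ = p × q`. As `μ` is primitive,
  -- the quotients, which are the coefficients sought, lie in `S`.
  have hαμ : ∀ i j, μ j * (crossProduct w q) i = μ i * (crossProduct w q) j := by
    intro i j
    rw [h0, h0, hα, hα]
    fin_cases i <;> fin_cases j <;>
      simp [-mul_eq_mul_left_iff, -mul_eq_mul_right_iff] <;>
      first
      | ring1
      | linear_combination q 0 * hdet
      | linear_combination q 1 * hdet
      | linear_combination q 2 * hdet
      | linear_combination -q 0 * hdet
      | linear_combination -q 1 * hdet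
      | linear_combination -q 2 * hdet
  have hβμ : ∀ i j, μ j * (crossProduct p w) i = μ i * (crossProduct p w) j := by
    intro i j
    rw [h0, h0, hβ, hβ]
    fin_cases i <;> fin_cases j <;>
      simp [-mul_eq_mul_left_iff, -mul_eq_mul_right_iff] <;>
      first
      | ring1
      | linear_combination p 0 * hdet
      | linear_combination p 1 * hdet
      | linear_combination p 2 * hdet
      | linear_combination -p 0 * hdet
      | linear_combination -p 1 * hdet
      | linear_combination -p 2 * hdet
  have hw : ∀ i j, μ i * w j = (crossProduct w q) i * p j + (crossProduct p w) i * q j := by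
    intro i j
    rw [h0, hα, hβ]
    fin_cases i <;> fin_cases j <;>
      simp <;>
      first
      | ring1
      | linear_combination hdet
  obtain ⟨i, hi⟩ := Function.ne_iff.1 hne
  obtain ⟨a, ha⟩ : μ i ∣ (crossProduct w q) i :=
    dvd_of_forall_dvd_mul hμ fun j => ⟨_, hαμ i j⟩
  obtain ⟨b, hb⟩ : μ i ∣ (crossProduct p w) i :=
    dvd_of_forall_dvd_mul hμ fun j => ⟨_, hβμ i j⟩
  refine ⟨a, b, funext fun j => mul_left_cancel₀ hi ?_⟩
  rw [hw, ha, hb]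
  simp only [Pi.add_apply, Pi.smul_apply, smul_eq_mul]
  ring

end Cramer

/-- A third variable is a nonzerodivisor modulo two others; membership is tested monomial by
monomial. -/
lemma MvPolynomial.mem_span_pair_X_of_X_mul_mem {k σ : Type*} [Field k] {i j l : σ}
    (hi : l ≠ i) (hj : l ≠ j) {p : MvPolynomial σ k}
    (h : X l * p ∈ Ideal.span (X '' {i, j} : Set (MvPolynomial σ k))) :
    p ∈ Ideal.span (X '' {i, j} : Set (MvPolynomial σ k)) := by
  classical
  rw [mem_ideal_span_X_image] at h ⊢
  intro m hm
  obtain ⟨t, ht, h0⟩ := h (m + Finsupp.single l 1) (by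
    rw [mem_support_iff, mul_comm, coeff_mul_X]
    exact mem_support_iff.1 hm)
  refine ⟨t, ht, ?_⟩
  have : l ≠ t := by rcases ht with rfl | rfl <;> assumption
  simpa [Finsupp.single_apply, this] using h0

lemma MvPolynomial.X_dvd_of_X_mul_eq {k σ : Type*} [Field k] {i j : σ} (hij : i ≠ j)
    {p q : MvPolynomial σ k} (h : X j * p = X i * q) : X i ∣ p := by
  have hp : Prime (X i : MvPolynomial σ k) := X_prime
  refine (hp.dvd_or_dvd ⟨q, h⟩).resolve_left fun hd => ?_
  rw [X_dvd_X] at hd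
  exact hij hd

/-! ### The depth obstruction to exactness -/

section Socle

variable {k : Type*} [Field k] [IsAlgClosed k] {r : ℕ}

/-- A proper ideal without zeros other than the origin has a socle element. -/
lemma MvPolynomial.exists_socle_element {I : Ideal (MvPolynomial (Fin r) k)} (htop : I ≠ ⊤)
    (hI : ∀ x : Fin r → k, x ≠ 0 → ∃ p ∈ I, eval x p ≠ 0) :
    ∃ s ∉ I, ∀ i, X i * s ∈ I := by
  set m := vanishingIdeal k ({0} : Set (Fin r → k)) with hm
  have hsub : zeroLocus k I ⊆ {0} := by
    intro x hx
    by_contra hx0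
    obtain ⟨p, hp, hpx⟩ := hI x hx0
    exact hpx (by simpa using hx p hp)
  have hle : m ≤ I.radical := by
    rw [← vanishingIdeal_zeroLocus_eq_radical (K := k)]
    exact vanishingIdeal_anti_mono hsub
  have hex : ∃ K, m ^ K ≤ I :=
    Ideal.exists_pow_le_of_le_radical_of_fg hle (IsNoetherian.noetherian m)
  classical
  -- With `K + 1` the least exponent such that `m ^ (K + 1) ≤ I`, any element of `m ^ K` outside `I`
  -- is a socle element.
  obtain ⟨K, hK⟩ : ∃ K, Nat.find hex = K + 1 := Nat.exists_eq_succ_of_ne_zero fun h => by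
    have := Nat.find_spec hex
    rw [h, pow_zero, Ideal.one_eq_top] at this
    exact htop (top_le_iff.1 this)
  have hspec := Nat.find_spec hex
  rw [hK] at hspec
  obtain ⟨s, hs, hsI⟩ := SetLike.not_le_iff_exists.1 (Nat.find_min hex (m := K) (by omega))
  refine ⟨s, hsI, fun i => hspec ?_⟩
  rw [pow_succ']
  exact Ideal.mul_mem_mul (by simp [hm]) hs

/-- A complex `S² → S³ → S` over a polynomial ring in at least three variables, whose second map has
entries without constant terms, fails to be exact, with injective first map and surjective second
map, at some point other than the origin. -/
lemma exists_not_exact (hr : 3 ≤ r) {p q v : Fin 3 → MvPolynomial (Fin r) k}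
    (hvp : v ⬝ᵥ p = 0) (hvq : v ⬝ᵥ q = 0) (hv0 : ∀ i, constantCoeff (v i) = 0) :
    ∃ x : Fin r → k, x ≠ 0 ∧ ((∀ i, eval x (v i) = 0) ∨
      ∀ i, eval x ((crossProduct p q) i) = 0) := by
  by_contra! hcon
  have : Nonempty (Fin r) := ⟨⟨0, by omega⟩⟩
  obtain ⟨⟨i, hi⟩, j, hj⟩ := hcon 1 one_ne_zero
  have hv : v ≠ 0 := fun h => hi (by simp [h])
  have hne : crossProduct p q ≠ 0 := fun h => hj (by simp [h])
  have hμ : ∀ g, (∀ i, g ∣ (crossProduct p q) i) → IsUnit g := by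
    intro g hg
    refine isUnit_of_no_zero (by omega) fun x hx hgx => ?_
    obtain ⟨-, j, hj⟩ := hcon x hx
    exact hj (zero_dvd_iff.1 (hgx ▸ map_dvd (eval x) (hg j)))
  set I := Ideal.span (Set.range v) with hI
  have hmem : ∀ f, f ∈ I ↔ ∃ w, v ⬝ᵥ w = f := by
    intro f
    rw [hI, Ideal.mem_span_range_iff_exists_fun]
    simp only [dotProduct, mul_comm]
  -- Write `X i * s = v ⬝ᵥ w i`. The differences `X j • w i - X i • w j` are orthogonal to `v`,
  -- hence combinations of `p` and `q`. The aim is to correct `w i₀` by such a combination until `X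
  -- i₀` divides it, which puts `s` in `I`.
  obtain ⟨s, hsI, hs⟩ := exists_socle_element (I := I)
    (span_ne_top_of_constantCoeff_eq_zero _ (by rintro _ ⟨i, rfl⟩; exact hv0 i))
    (fun x hx => by
      obtain ⟨⟨i, hi⟩, -⟩ := hcon x hx
      exact ⟨v i, Ideal.subset_span ⟨i, rfl⟩, hi⟩)
  choose w hw using fun i => (hmem _).1 (hs i)
  have key : ∀ i j, ∃ a b : MvPolynomial (Fin r) k,
      (X j : MvPolynomial (Fin r) k) • w i - (X i : MvPolynomial (Fin r) k) • w j
        = a • p + b • q := by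
    intro i j
    refine exists_eq_combination_of_orthogonal hv hvp hvq ?_ hμ hne
    rw [dotProduct_sub, dotProduct_smul, dotProduct_smul, hw, hw]
    simp only [smul_eq_mul]
    ring
  have inj : ∀ a b : MvPolynomial (Fin r) k, a • p + b • q = 0 → a = 0 ∧ b = 0 := by
    intro a b hab
    obtain ⟨i, hi⟩ := Function.ne_iff.1 hne
    have h0 := congrFun hab 0
    have h1 := congrFun hab 1
    have h2 := congrFun hab 2
    rw [cross_apply, Pi.zero_apply] at hi
    simp only [Pi.add_apply, Pi.smul_apply, smul_eq_mul, Pi.zero_apply] at h0 h1 h2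
    constructor <;> refine mul_left_cancel₀ hi ?_ <;> rw [mul_zero]
    · fin_cases i <;> simp [-mul_eq_zero]
      · linear_combination q 2 * h1 - q 1 * h2
      · linear_combination q 0 * h2 - q 2 * h0
      · linear_combination q 1 * h0 - q 0 * h1
    · fin_cases i <;> simp [-mul_eq_zero]
      · linear_combination p 1 * h2 - p 2 * h1
      · linear_combination p 2 * h0 - p 0 * h2
      · linear_combination p 0 * h1 - p 1 * h0
  let i₀ : Fin r := ⟨0, by omega⟩
  let i₁ : Fin r := ⟨1, by omega⟩
  let i₂ : Fin r := ⟨2, by omega⟩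
  have h01 : i₀ ≠ i₁ := by simp [i₀, i₁]
  have h20 : i₂ ≠ i₀ := by simp [i₀, i₂]
  have h21 : i₂ ≠ i₁ := by simp [i₁, i₂]
  obtain ⟨a01, b01, e01⟩ := key i₀ i₁
  obtain ⟨a02, b02, e02⟩ := key i₀ i₂
  obtain ⟨a12, b12, e12⟩ := key i₁ i₂
  -- The coefficients satisfy the Koszul cocycle relation because `p` and `q` are independent; a
  -- third variable is needed for this.
  obtain ⟨ha, hb⟩ := inj (X i₂ * a01 - X i₁ * a02 + X i₀ * a12)
    (X i₂ * b01 - X i₁ * b02 + X i₀ * b12) (by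
      have : (X i₂ : MvPolynomial (Fin r) k) • (a01 • p + b01 • q) -
          (X i₁ : MvPolynomial (Fin r) k) • (a02 • p + b02 • q) +
          (X i₀ : MvPolynomial (Fin r) k) • (a12 • p + b12 • q) = 0 := by
        rw [← e01, ← e02, ← e12]
        module
      rw [← this]
      module)
  have split : ∀ {a a' a'' : MvPolynomial (Fin r) k}, X i₂ * a - X i₁ * a' + X i₀ * a'' = 0 →
      ∃ c c', a = X i₁ * c - X i₀ * c' := by
    intro a a' a'' h
    have hm := mem_span_pair_X_of_X_mul_mem h20 h21 (p := a) (by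
      rw [Set.image_pair, Ideal.mem_span_pair]
      exact ⟨-a'', a', by linear_combination -h⟩)
    rw [Set.image_pair, Ideal.mem_span_pair] at hm
    obtain ⟨c, c', h⟩ := hm
    exact ⟨c', -c, by linear_combination -h⟩
  obtain ⟨c, c', rfl⟩ := split ha
  obtain ⟨e, e', rfl⟩ := split hb
  -- Substituting the split coefficients in `e01` gives `X i₁ • (w i₀ - c • p - e • q) = X i₀ • (w
  -- i₁ - c' • p - e' • q)`.
  have hdvd : ∀ l, X i₀ ∣ (w i₀ - (c • p + e • q)) l := fun l =>
    X_dvd_of_X_mul_eq h01 (q := (w i₁ - (c' • p + e' • q)) l) (by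
      have := congrFun e01 l
      simp only [Pi.add_apply, Pi.sub_apply, Pi.smul_apply, smul_eq_mul] at this ⊢
      linear_combination this)
  choose u hu using hdvd
  refine hsI ((hmem s).2 ⟨u, mul_left_cancel₀ (X_ne_zero i₀) ?_⟩)
  rw [← hw i₀, ← smul_eq_mul, ← dotProduct_smul]
  have : (X i₀ : MvPolynomial (Fin r) k) • u = w i₀ - (c • p + e • q) := funext fun l => (hu l).symm
  rw [this]
  simp [dotProduct_sub, dotProduct_add, dotProduct_smul, hvp, hvq]

end Socle

/-! ### Rank bounds over a field -/

namespace Matrix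

variable {K m n : Type*} [Field K] [Fintype n]

lemma rank_add_le_rank (A B : Matrix m n K) : (A + B).rank ≤ A.rank + B.rank := by
  rw [Matrix.rank, Matrix.rank, Matrix.rank, mulVecLin_add]
  refine (Submodule.finrank_mono (LinearMap.range_add_le _ _)).trans ?_
  exact Submodule.finrank_add_le_finrank_add_finrank _ _

lemma eq_zero_of_rank_eq_zero {A : Matrix m n K} (h : A.rank = 0) : A = 0 := by
  classical
  rw [Matrix.rank, Submodule.finrank_eq_zero, LinearMap.range_eq_bot] at h
  exact (LinearEquiv.map_eq_zero_iff toLin').1 (by rw [toLin'_apply', h])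

variable [Fintype m]

/-- If the nonzero entries of a matrix are covered by the rows in `s` and the columns in `t`, then
its rank is at most `|s| + |t|`. -/
lemma rank_le_card_add_card (A : Matrix m n K) (s : Finset m) (t : Finset n)
    (h : ∀ i ∉ s, ∀ j ∉ t, A i j = 0) : A.rank ≤ s.card + t.card := by
  classical
  have hA : A = (of fun i j => if i ∈ s then A i j else 0) +
      of fun i j => if i ∈ s then 0 else A i j := by
    ext i j
    by_cases hi : i ∈ s <;> simp [hi]
  rw [hA]
  refine (rank_add_le_rank _ _).trans (add_le_add ?_ ?_)
  · refine rank_le_card_of_support_subset _ s (Function.support_subset_iff'.2 fun i hi => ?_)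
    ext j
    simp [Matrix.row, Finset.mem_coe.not.1 hi]
  · rw [← rank_transpose]
    refine rank_le_card_of_support_subset _ t (Function.support_subset_iff'.2 fun j hj => ?_)
    ext i
    by_cases hi : i ∈ s
    · simp [Matrix.row, hi]
    · simp [Matrix.row, hi, h i hi j (Finset.mem_coe.not.1 hj)]

lemma rank_lt_card_of_det_eq_zero [DecidableEq n] {A : Matrix n n K} (h : A.det = 0) :
    A.rank < Fintype.card n := by
  obtain ⟨v, hv, hAv⟩ := exists_mulVec_eq_zero_iff.2 h
  have h0 : A * replicateCol Unit v = 0 := by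
    ext i j
    simpa [mul_apply, mulVec, dotProduct] using congrFun hAv i
  have h1 := rank_add_rank_le_card_of_mul_eq_zero h0
  have h2 : (replicateCol Unit v).rank ≠ 0 := by
    intro h
    exact hv (funext fun i => congrFun₂ (eq_zero_of_rank_eq_zero h) i ())
  omega

/-- A square-zero matrix of size `2n` and rank `n` whose last `n` rows vanish has an invertible
upper right block. -/
lemma det_ne_zero_of_rank_fromBlocks [DecidableEq n] {A B : Matrix n n K} (hA : A * A = 0)
    (hAB : A * B = 0)
    (h : Fintype.card n ≤ (fromBlocks A B (0 : Matrix n n K) (0 : Matrix n n K)).rank) :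
    B.det ≠ 0 := by
  intro hB
  have h1 : fromBlocks A B (0 : Matrix n n K) (0 : Matrix n n K) =
      fromRows (1 : Matrix n n K) (0 : Matrix n n K) * fromCols A B := by
    rw [fromRows_mul_fromCols]
    simp
  -- Hence `rank A + rank [A B] ≤ n`; since `[A B]` has rank at least `n`, this forces `A = 0`.
  have h2 : A * fromCols A B = 0 := by
    rw [mul_fromCols, hA, hAB, fromCols_zero]
  have h3 := rank_add_rank_le_card_of_mul_eq_zero h2
  have h4 := h1 ▸ rank_mul_le_right (fromRows (1 : Matrix n n K) (0 : Matrix n n K))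
    (fromCols A B)
  have h5 : A = 0 := eq_zero_of_rank_eq_zero (by omega)
  have h6 : fromBlocks A B (0 : Matrix n n K) (0 : Matrix n n K) =
      fromRows (1 : Matrix n n K) (0 : Matrix n n K) *
      (B * fromCols (0 : Matrix n n K) (1 : Matrix n n K)) := by
    rw [mul_fromCols, fromRows_mul_fromCols, h5]
    simp
  have h7 := h6 ▸ rank_mul_le_right (fromRows (1 : Matrix n n K) (0 : Matrix n n K))
    (B * fromCols (0 : Matrix n n K) (1 : Matrix n n K))
  have h8 := rank_mul_le_left B (fromCols (0 : Matrix n n K) (1 : Matrix n n K))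
  have h9 := rank_lt_card_of_det_eq_zero hB
  omega

end Matrix

lemma exists_smul_eq_of_crossProduct_eq_zero {K : Type*} [Field K] {p q : Fin 3 → K}
    (h : crossProduct p q = 0) : ∃ (a : Fin 3 → K) (b c : K), p = b • a ∧ q = c • a := by
  by_cases hp : p = 0
  · exact ⟨q, 0, 1, by simp [hp], by simp⟩
  · obtain ⟨i, hi⟩ := Function.ne_iff.1 hp
    rw [Pi.zero_apply] at hi
    rw [cross_apply] at h
    have h0 := congrFun h 0
    have h1 := congrFun h 1
    have h2 := congrFun h 2
    simp at h0 h1 h2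
    refine ⟨p, 1, q i / p i, by simp, funext fun j => ?_⟩
    rw [Pi.smul_apply, smul_eq_mul, div_mul_eq_mul_div, eq_div_iff hi]
    fin_cases i <;> fin_cases j <;> simp <;>
      first
      | ring1
      | linear_combination h0
      | linear_combination h1
      | linear_combination h2
      | linear_combination -h0
      | linear_combination -h1
      | linear_combination -h2

/-! ### Square-zero families -/

/-- A matrix of polynomials without constant terms which is strictly upper triangular, squares to
zero, and has rank at least `n` at every point other than the origin. -/
structure IsSquareZeroFamily {k : Type*} [Field k] {r N : ℕ} (n : ℕ)
    (X : Matrix (Fin N) (Fin N) (MvPolynomial (Fin r) k)) : Prop where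
  upper : ∀ i j, j ≤ i → X i j = 0
  constantCoeff_eq : ∀ i j, constantCoeff (X i j) = 0
  sq : X * X = 0
  rank : ∀ x : Fin r → k, x ≠ 0 → n ≤ (X.map (eval x)).rank

namespace IsSquareZeroFamily

variable {k : Type*} [Field k] {r N n : ℕ} {X : Matrix (Fin N) (Fin N) (MvPolynomial (Fin r) k)}

/-- Reflection in the antidiagonal exchanges last rows with first columns, so each argument on rows
also serves for columns. -/
lemma antitranspose (hX : IsSquareZeroFamily n X) :
    IsSquareZeroFamily n (X.submatrix Fin.rev Fin.rev).transpose where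
  upper i j hij := hX.upper _ _ (Fin.rev_le_rev.2 hij)
  constantCoeff_eq i j := hX.constantCoeff_eq _ _
  sq := by
    rw [← Matrix.transpose_mul]
    have := Matrix.submatrix_mul_equiv X X Fin.rev Fin.revPerm Fin.rev
    simp only [hX.sq] at this
    rw [show (Fin.rev : Fin N → Fin N) = ⇑(Fin.revPerm : Equiv.Perm (Fin N)) from rfl] at this ⊢
    rw [this]
    rfl
  rank x hx := by
    have : ((X.submatrix Fin.rev Fin.rev).transpose).map (eval x) =
        ((X.map (eval x)).submatrix Fin.revPerm Fin.revPerm).transpose := rfl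
    rw [this, Matrix.rank_transpose, Matrix.rank_submatrix]
    exact hX.rank x hx

lemma le_card_add_card (hX : IsSquareZeroFamily n X) {x : Fin r → k} (hx : x ≠ 0)
    (s t : Finset (Fin N)) (h : ∀ i ∉ s, ∀ j ∉ t, eval x (X i j) = 0) : n ≤ s.card + t.card :=
  (hX.rank x hx).trans (Matrix.rank_le_card_add_card _ s t h)

variable [IsAlgClosed k]

/-- In at least two variables, the last `n` rows of a square-zero family of size `2n` are not all
zero. -/
lemma not_rows_eq_zero (hX : IsSquareZeroFamily n X) (hr : 2 ≤ r) (hn : 0 < n) (hN : n + n = N)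
    (h : ∀ i j : Fin N, n ≤ (i : ℕ) → X i j = 0) : False := by
  subst hN
  set A := X.submatrix (Fin.castAdd n) (Fin.castAdd n) with hA
  set B := X.submatrix (Fin.castAdd n) (Fin.natAdd n) with hB
  have hXe : X.submatrix finSumFinEquiv finSumFinEquiv = Matrix.fromBlocks A B 0 0 := by
    ext i j
    rcases i with i | i <;> rcases j with j | j <;> simp [hA, hB, h]
  have hsq : X.submatrix finSumFinEquiv finSumFinEquiv *
      X.submatrix finSumFinEquiv finSumFinEquiv = 0 := by
    rw [Matrix.submatrix_mul_equiv, hX.sq]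
    rfl
  rw [hXe, Matrix.fromBlocks_multiply, ← Matrix.fromBlocks_zero, Matrix.fromBlocks_inj] at hsq
  simp only [Matrix.mul_zero, add_zero] at hsq
  have : Nonempty (Fin n) := ⟨⟨0, hn⟩⟩
  obtain ⟨x, hx, hdet⟩ := exists_zero_of_constantCoeff_eq_zero hr (p := B.det) (by
    rw [RingHom.map_det]
    have : (constantCoeff (R := k)).mapMatrix B = 0 := by
      ext i j
      exact hX.constantCoeff_eq _ _
    rw [this, Matrix.det_zero])
  rw [RingHom.map_det] at hdet
  refine Matrix.det_ne_zero_of_rank_fromBlocks (A := (eval x).mapMatrix A) ?_ ?_ ?_ hdet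
  · rw [← map_mul, hsq.1, map_zero]
  · rw [← map_mul, hsq.2.1, map_zero]
  · have h1 := hX.rank x hx
    rw [← Matrix.rank_submatrix _ (finSumFinEquiv (m := n) (n := n)) finSumFinEquiv,
      Matrix.submatrix_map, hXe, Matrix.fromBlocks_map] at h1
    simpa using h1

lemma not_cols_eq_zero (hX : IsSquareZeroFamily n X) (hr : 2 ≤ r) (hn : 0 < n) (hN : n + n = N)
    (h : ∀ i j : Fin N, (j : ℕ) < n → X i j = 0) : False :=
  hX.antitranspose.not_rows_eq_zero hr hn hN fun i j hi => h _ _ (by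
    rw [Fin.val_rev]
    omega)

end IsSquareZeroFamily

namespace IsSquareZeroFamily

variable {k : Type*} [Field k] {r : ℕ}

/-! ### Size four -/

section Size4

variable [IsAlgClosed k] {X : Matrix (Fin 4) (Fin 4) (MvPolynomial (Fin r) k)}

lemma false_of_size_four (hX : IsSquareZeroFamily 2 X) (hr : 3 ≤ r) : False := by
  have hsq : ∀ i j, ∑ l, X i l * X l j = 0 := fun i j => congrFun₂ hX.sq i j
  simp only [Fin.sum_univ_four] at hsq
  have hup := hX.upper
  have h02 := hsq 0 2
  have h13 := hsq 1 3
  simp [hup] at h02 h13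
  by_cases h12 : X 1 2 = 0
  -- At this point only the last column can be nonzero, so the rank is at most 1.
  · obtain ⟨x, hx, h1, h2⟩ := exists_common_zero_of_constantCoeff_eq_zero hr
      (hX.constantCoeff_eq 0 1) (hX.constantCoeff_eq 0 2)
    have := hX.le_card_add_card hx ∅ {3} (by
      intro i _ j hj
      fin_cases i <;> fin_cases j <;> simp_all)
    simp at this
  · refine hX.not_rows_eq_zero (by omega) two_pos rfl fun i j hi => ?_
    fin_cases i <;> fin_cases j <;> simp_all

end Size4

/-! ### Size six -/

section Size6

variable {X : Matrix (Fin 6) (Fin 6) (MvPolynomial (Fin r) k)}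

lemma rows_eq_zero_of_size_six (hX : IsSquareZeroFamily 3 X) (h34 : X 3 4 = 0) (h35 : X 3 5 = 0)
    (h45 : X 4 5 = 0) : ∀ i j : Fin 6, 3 ≤ (i : ℕ) → X i j = 0 := by
  intro i j hi
  rcases le_or_gt j i with h | h
  · exact hX.upper _ _ h
  · fin_cases i <;> fin_cases j <;>
      first
      | exact absurd h (by decide)
      | exact absurd hi (by decide)
      | assumption

lemma false_of_four_cols_eq_zero (hX : IsSquareZeroFamily 3 X) {x : Fin r → k} (hx : x ≠ 0)
    (h01 : eval x (X 0 1) = 0) (h02 : eval x (X 0 2) = 0) (h03 : eval x (X 0 3) = 0)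
    (h12 : eval x (X 1 2) = 0) (h13 : eval x (X 1 3) = 0) (h23 : eval x (X 2 3) = 0) : False := by
  have := hX.le_card_add_card hx ∅ {4, 5} (by
    intro i _ j hj
    rcases le_or_gt j i with h | h
    · rw [hX.upper _ _ h, map_zero]
    · fin_cases i <;> fin_cases j <;>
        first
        | exact absurd h (by decide)
        | exact absurd (by decide) hj
        | assumption)
  simp at this

lemma false_of_row_and_col (hX : IsSquareZeroFamily 3 X) {x : Fin r → k} (hx : x ≠ 0)
    (h12 : eval x (X 1 2) = 0) (h13 : eval x (X 1 3) = 0) (h14 : eval x (X 1 4) = 0)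
    (h23 : eval x (X 2 3) = 0) (h24 : eval x (X 2 4) = 0) (h34 : eval x (X 3 4) = 0) : False := by
  have := hX.le_card_add_card hx {0} {5} (by
    intro i hi j hj
    rcases le_or_gt j i with h | h
    · rw [hX.upper _ _ h, map_zero]
    · fin_cases i <;> fin_cases j <;>
        first
        | exact absurd h (by decide)
        | exact absurd (by decide) hi
        | exact absurd (by decide) hj
        | assumption)
  simp at this

/-- Passing through a `3 × 3` middle factor makes the rank of `X` drop below 3 wherever the
determinant of that factor vanishes. -/
lemma _root_.Matrix.eq_mul_of_block_form {S : Type*} [CommRing S] {X : Matrix (Fin 6) (Fin 6) S}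
    {u₁ u₂ v w z₁ z₂ : S} (hup : ∀ i j, j ≤ i → X i j = 0) (h01 : X 0 1 = 0) (h23 : X 2 3 = 0)
    (h45 : X 4 5 = 0) (h02 : X 0 2 = u₁ * v) (h03 : X 0 3 = u₁ * w) (h12 : X 1 2 = u₂ * v)
    (h13 : X 1 3 = u₂ * w) (h24 : X 2 4 = w * z₁) (h25 : X 2 5 = w * z₂) (h34 : X 3 4 = -v * z₁)
    (h35 : X 3 5 = -v * z₂) :
    X = !![1, 0, 0; 0, 1, 0; 0, 0, w; 0, 0, -v; 0, 0, 0; 0, 0, 0] *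
      !![u₁, X 0 4, X 0 5; u₂, X 1 4, X 1 5; 0, z₁, z₂] *
      !![0, 0, v, w, 0, 0; 0, 0, 0, 0, 1, 0; 0, 0, 0, 0, 0, 1] := by
  ext i j
  fin_cases i <;> fin_cases j <;>
    simp [Matrix.mul_apply, Fin.sum_univ_three, hup, h01, h23, h45, h02, h03, h12, h13, h24, h25,
      h34, h35]

variable [IsAlgClosed k]

/-- In at least two variables, the first two columns and the last two rows of a square-zero family
of size six are not all zero. -/
lemma not_two_rows_and_cols_eq_zero (hX : IsSquareZeroFamily 3 X) (hr : 2 ≤ r)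
    (h4 : ∀ j, X 4 j = 0) (h5 : ∀ j, X 5 j = 0) (h0 : ∀ i, X i 0 = 0) (h1 : ∀ i, X i 1 = 0) :
    False := by
  have hsq : ∀ i j, ∑ l, X i l * X l j = 0 := fun i j => congrFun₂ hX.sq i j
  simp only [Fin.sum_univ_six, h4, h5, h0, h1, zero_mul, mul_zero, add_zero, zero_add] at hsq
  have hup := hX.upper
  have hrow3 : ¬ (X 3 4 = 0 ∧ X 3 5 = 0) := by
    rintro ⟨h34, h35⟩
    exact hX.not_rows_eq_zero hr three_pos rfl (hX.rows_eq_zero_of_size_six h34 h35 (h4 5))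
  have h24 := hsq 2 4
  have h25 := hsq 2 5
  have e04 := hsq 0 4
  have e05 := hsq 0 5
  have e14 := hsq 1 4
  have e15 := hsq 1 5
  simp only [hup 2 2 le_rfl, zero_mul, zero_add] at h24 h25
  have h23 : X 2 3 = 0 := by
    by_contra h
    exact hrow3 ⟨(mul_eq_zero.1 h24).resolve_left h, (mul_eq_zero.1 h25).resolve_left h⟩
  -- This block annihilates the columns `(X 2 4, X 3 4)` and `(X 2 5, X 3 5)`; were it nonsingular,
  -- row 3 would vanish.
  have hdet : X 0 2 * X 1 3 = X 0 3 * X 1 2 := by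
    by_contra hne
    have hne' : X 0 2 * X 1 3 - X 0 3 * X 1 2 ≠ 0 := sub_ne_zero.2 hne
    refine hrow3 ⟨mul_left_cancel₀ hne' ?_, mul_left_cancel₀ hne' ?_⟩
    · linear_combination X 0 2 * e14 - X 1 2 * e04
    · linear_combination X 0 2 * e15 - X 1 2 * e05
  obtain ⟨u₁, u₂, v, w, hvw, h02, h03, h12, h13⟩ := exists_rank_one_factorization hdet
  have hone : (1 : Fin r → k) ≠ 0 := by
    have : Nonempty (Fin r) := ⟨⟨0, by omega⟩⟩
    exact one_ne_zero
  have hu : u₁ ≠ 0 ∨ u₂ ≠ 0 := by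
    by_contra! hu
    rw [hu.1] at h02 h03
    rw [hu.2] at h12 h13
    rw [zero_mul] at h02 h03 h12 h13
    exact hX.false_of_four_cols_eq_zero hone (by rw [h1, map_zero]) (by rw [h02, map_zero])
      (by rw [h03, map_zero]) (by rw [h12, map_zero]) (by rw [h13, map_zero])
      (by rw [h23, map_zero])
  rw [h02, h03] at e04 e05
  rw [h12, h13] at e14 e15
  have hz : ∀ {a b}, u₁ * v * a + u₁ * w * b = 0 → u₂ * v * a + u₂ * w * b = 0 →
      ∃ z, a = w * z ∧ b = -v * z := by
    intro a b ha hb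
    refine hvw.exists_of_mul_add_mul_eq_zero ?_
    rcases hu with hu | hu <;> refine mul_left_cancel₀ hu ?_
    · linear_combination ha
    · linear_combination hb
  obtain ⟨z₁, hz24, hz34⟩ := hz e04 e14
  obtain ⟨z₂, hz25, hz35⟩ := hz e05 e15
  set D : Matrix (Fin 3) (Fin 3) (MvPolynomial (Fin r) k) :=
    !![u₁, X 0 4, X 0 5; u₂, X 1 4, X 1 5; 0, z₁, z₂] with hD
  have hfac := Matrix.eq_mul_of_block_form hX.upper (h1 0) h23 (h4 5) h02 h03 h12 h13 hz24 hz25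
    hz34 hz35
  rw [← hD] at hfac
  -- The `u`'s and `z`'s may have constant terms, but each term of the determinant contains one of
  -- `X 0 4`, `X 0 5`, `X 1 4`, `X 1 5`.
  obtain ⟨x, hx, hdetx⟩ := exists_zero_of_constantCoeff_eq_zero hr (p := D.det) (by
    simp [hD, Matrix.det_fin_three, hX.constantCoeff_eq])
  have hrank := hX.rank x hx
  rw [hfac, Matrix.map_mul, Matrix.map_mul] at hrank
  rw [RingHom.map_det] at hdetx
  have h3 := Matrix.rank_lt_card_of_det_eq_zero hdetx
  have h4 := (Matrix.rank_mul_le_left _ _).trans' hrank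
  have h5 := (Matrix.rank_mul_le_right _ _).trans' h4
  rw [Fintype.card_fin] at h3
  exact absurd h5 (not_le.2 h3)

/-- In the column-times-row factorization, one factor must have both entries without constant term,
so two equations suffice instead of four. -/
lemma exists_common_zero_of_det_eq_zero (hr : 3 ≤ r) {a b c d : MvPolynomial (Fin r) k}
    (ha : constantCoeff a = 0) (hb : constantCoeff b = 0) (hc : constantCoeff c = 0)
    (hd : constantCoeff d = 0) (h : a * d = b * c) :
    ∃ x : Fin r → k, x ≠ 0 ∧ eval x a = 0 ∧ eval x b = 0 ∧ eval x c = 0 ∧ eval x d = 0 := by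
  obtain ⟨u₁, u₂, v, w, -, rfl, rfl, rfl, rfl⟩ := exists_rank_one_factorization h
  rw [map_mul, mul_eq_zero] at ha hb hc hd
  have : constantCoeff u₁ = 0 ∧ constantCoeff u₂ = 0 ∨
      constantCoeff v = 0 ∧ constantCoeff w = 0 := by tauto
  rcases this with ⟨h1, h2⟩ | ⟨h1, h2⟩ <;>
  · obtain ⟨x, hx, e1, e2⟩ := exists_common_zero_of_constantCoeff_eq_zero hr h1 h2
    exact ⟨x, hx, by simp [e1, e2]⟩

lemma false_of_size_six_of_ne_zero_of_ne_zero (hX : IsSquareZeroFamily 3 X) (hr : 3 ≤ r)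
    (h01 : X 0 1 ≠ 0) (h45 : X 4 5 ≠ 0) : False := by
  have hsq : ∀ i j, ∑ l, X i l * X l j = 0 := fun i j => congrFun₂ hX.sq i j
  simp only [Fin.sum_univ_six] at hsq
  have hup := hX.upper
  have h12 := hsq 0 2
  have h34 := hsq 3 5
  simp [hup, h01, h45] at h12 h34
  have e03 := hsq 0 3
  have e04 := hsq 0 4
  simp [hup, h34] at e03 e04
  clear hsq
  obtain ⟨x, hx, h13, h14, h23, h24⟩ := exists_common_zero_of_det_eq_zero hr
    (hX.constantCoeff_eq 1 3) (hX.constantCoeff_eq 1 4) (hX.constantCoeff_eq 2 3)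
    (hX.constantCoeff_eq 2 4) (mul_left_cancel₀ h01
      (by linear_combination X 2 4 * e03 - X 2 3 * e04))
  exact hX.false_of_row_and_col hx (by rw [h12, map_zero]) h13 h14 h23 h24 (by rw [h34, map_zero])

lemma false_of_size_six_of_ne_zero_of_eq_zero (hX : IsSquareZeroFamily 3 X) (hr : 3 ≤ r)
    (h01 : X 0 1 ≠ 0) (h45 : X 4 5 = 0) : False := by
  have hsq : ∀ i j, ∑ l, X i l * X l j = 0 := fun i j => congrFun₂ hX.sq i j
  simp only [Fin.sum_univ_six] at hsq
  have hup := hX.upper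
  have h12 := hsq 0 2
  simp [hup, h01] at h12
  have e04 := hsq 0 4
  have e05 := hsq 0 5
  have e14 := hsq 1 4
  have e15 := hsq 1 5
  have e24 := hsq 2 4
  have e25 := hsq 2 5
  simp only [hup _ _ (le_refl _), h12, h45, zero_mul, mul_zero, zero_add, add_zero,
    hup 1 0 (by decide), hup 2 0 (by decide), hup 2 1 (by decide),
    hup 5 4 (by decide)] at e04 e05 e14 e15 e24 e25
  have hrow3 : ¬ (X 3 4 = 0 ∧ X 3 5 = 0) := by
    rintro ⟨h34, h35⟩
    exact hX.not_rows_eq_zero (by omega) three_pos rfl (hX.rows_eq_zero_of_size_six h34 h35 h45)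
  have h13 : X 1 3 = 0 := by
    by_contra h
    exact hrow3 ⟨(mul_eq_zero.1 e14).resolve_left h, (mul_eq_zero.1 e15).resolve_left h⟩
  have h23 : X 2 3 = 0 := by
    by_contra h
    exact hrow3 ⟨(mul_eq_zero.1 e24).resolve_left h, (mul_eq_zero.1 e25).resolve_left h⟩
  -- The complex comes from row 0 and columns 4 and 5 of `X`. Failure of either map at `x` makes the
  -- rank at most 2.
  obtain ⟨x, hx, hv | hμ⟩ := exists_not_exact hr (p := ![X 1 4, X 2 4, X 3 4])
    (q := ![X 1 5, X 2 5, X 3 5]) (v := ![X 0 1, X 0 2, X 0 3])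
    (by simpa [dotProduct, Fin.sum_univ_three] using e04)
    (by simpa [dotProduct, Fin.sum_univ_three] using e05)
    (by intro i; fin_cases i <;> exact hX.constantCoeff_eq _ _)
  · have e1 := hv 0
    have e2 := hv 1
    have e3 := hv 2
    simp at e1 e2 e3
    exact hX.false_of_four_cols_eq_zero hx e1 e2 e3 (by rw [h12, map_zero])
      (by rw [h13, map_zero]) (by rw [h23, map_zero])
  · have hcross : crossProduct ![eval x (X 1 4), eval x (X 2 4), eval x (X 3 4)]
        ![eval x (X 1 5), eval x (X 2 5), eval x (X 3 5)] = 0 := by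
      ext i
      have := hμ i
      rw [cross_apply] at this ⊢
      fin_cases i <;> simpa using this
    obtain ⟨a, b, c, hp, hq⟩ := exists_smul_eq_of_crossProduct_eq_zero hcross
    have hp0 := congrFun hp 0
    have hp1 := congrFun hp 1
    have hp2 := congrFun hp 2
    have hq0 := congrFun hq 0
    have hq1 := congrFun hq 1
    have hq2 := congrFun hq 2
    simp at hp0 hp1 hp2 hq0 hq1 hq2
    have hfac : X.map (eval x) = !![1, 0; 0, a 0; 0, a 1; 0, a 2; 0, 0; 0, 0] *
        !![0, eval x (X 0 1), eval x (X 0 2), eval x (X 0 3), eval x (X 0 4), eval x (X 0 5);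
          0, 0, 0, 0, b, c] := by
      ext1 i j
      fin_cases i <;> fin_cases j <;>
        simp [Matrix.mul_apply, hup, h12, h13, h23, h45, hp0, hp1, hp2, hq0, hq1, hq2, mul_comm]
    have hrank := hX.rank x hx
    rw [hfac] at hrank
    have := (Matrix.rank_mul_le_left _ _).trans' hrank
    have := (Matrix.rank_le_card_width _).trans' this
    simp at this

lemma false_of_size_six (hX : IsSquareZeroFamily 3 X) (hr : 3 ≤ r) : False := by
  have hup := hX.upper
  by_cases h01 : X 0 1 = 0 <;> by_cases h45 : X 4 5 = 0
  · refine hX.not_two_rows_and_cols_eq_zero (by omega) ?_ ?_ ?_ ?_ <;> intro i <;>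
      fin_cases i <;> first | assumption | exact hup _ _ (by decide)
  · exact hX.antitranspose.false_of_size_six_of_ne_zero_of_eq_zero hr h45 h01
  · exact hX.false_of_size_six_of_ne_zero_of_eq_zero hr h01 h45
  · exact hX.false_of_size_six_of_ne_zero_of_ne_zero hr h01 h45

end Size6

end IsSquareZeroFamily

/-! ### The numerical bound -/

namespace IsSquareZeroFamily

variable {k : Type*} [Field k] [IsAlgClosed k] {r n R C : ℕ}

/-- The bound `N ≥ 2 ^ (r - 1) (R + C)` for square-zero families of size `N = 2n < 8` whose last
`R` rows and first `C` columns vanish. -/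
lemma two_pow_mul_le {X : Matrix (Fin (2 * n)) (Fin (2 * n)) (MvPolynomial (Fin r) k)}
    (hX : IsSquareZeroFamily n X) (hn : 1 ≤ n) (hN : 2 * n < 8) (hr : 1 ≤ r)
    (hR : 1 ≤ R) (hC : 1 ≤ C) (hRX : ∀ i j : Fin (2 * n), 2 * n ≤ i + R → X i j = 0)
    (hCX : ∀ i j : Fin (2 * n), (j : ℕ) < C → X i j = 0) :
    2 ^ (r - 1) * (R + C) ≤ 2 * n := by
  -- For `r = 1` the rank at one point is at most `2n - R` and at most `2n - C`, so `R, C ≤ n`.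
  rcases hr.eq_or_lt with rfl | hr
  · have hone : (1 : Fin 1 → k) ≠ 0 := one_ne_zero
    have h1 := hX.le_card_add_card hone (Finset.univ.filter fun i => (i : ℕ) < 2 * n - R) ∅
      fun i hi j _ => by
        rw [hRX i j (by simp at hi; omega), map_zero]
    have h2 := hX.le_card_add_card hone ∅ (Finset.univ.filter fun i => C ≤ (i : ℕ))
      fun i _ j hj => by
        rw [hCX i j (by simpa using hj), map_zero]
    have h3 : (Finset.univ.filter fun i : Fin (2 * n) => (i : ℕ) < 2 * n - R).card
        = 2 * n - R := by
      rw [Fin.card_filter_val_lt]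
      omega
    have h4 : (Finset.univ.filter fun i : Fin (2 * n) => C ≤ (i : ℕ)).card = 2 * n - C := by
      have h5 := Finset.card_filter_add_card_filter_not (s := Finset.univ)
        fun i : Fin (2 * n) => (i : ℕ) < C
      rw [Fin.card_filter_val_lt, Finset.card_fin] at h5
      simp only [not_lt] at h5
      omega
    rw [h3, Finset.card_empty] at h1
    rw [h4, Finset.card_empty] at h2
    omega
  · have hRn : R < n := by
      by_contra! h
      exact hX.not_rows_eq_zero hr hn (two_mul n).symm fun i j hi => hRX i j (by omega)
    have hCn : C < n := by
      by_contra! h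
      exact hX.not_cols_eq_zero hr hn (two_mul n).symm fun i j hj => hCX i j (by omega)
    obtain rfl | rfl : n = 2 ∨ n = 3 := by omega
    · obtain rfl : r = 2 := by
        by_contra h
        exact hX.false_of_size_four (by omega)
      omega
    · obtain rfl : r = 2 := by
        by_contra h
        exact hX.false_of_size_six (by omega)
      by_contra h
      obtain ⟨rfl, rfl⟩ : R = 2 ∧ C = 2 := by omega
      exact hX.not_two_rows_and_cols_eq_zero le_rfl (fun j => hRX 4 j (by decide))
        (fun j => hRX 5 j (by decide)) (fun i => hCX i 0 (by decide)) fun i => hCX i 1 (by decide)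

end IsSquareZeroFamily

/-! ### From morphisms to square-zero families -/

namespace SquareZero

variable {k : Type*} [Field k] {N : ℕ} {d : Fin N → ℤ}

/-- The weights of the `(i, l)` and `(l, j)` entries have a sum independent of `l`, so the action
preserves `X ^ 2 = 0`. -/
lemma scale_mul_scale (c : kˣ) (Y Z : Matrix (Fin N) (Fin N) k) (i j : Fin N) :
    (scale d c Y * scale d c Z) i j = ((c ^ (d i - d j + 2) : kˣ) : k) * (Y * Z) i j := by
  rw [Matrix.mul_apply, Matrix.mul_apply, Finset.mul_sum]
  refine Finset.sum_congr rfl fun l _ => ?_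
  have h : c ^ (d i - d j + 2) = c ^ (d i - d l + 1) * c ^ (d l - d j + 1) := by
    rw [← zpow_add]
    congr 1
    ring
  rw [h, Units.val_mul]
  simp only [scale, Matrix.of_apply]
  ring

/-- The conditions defining `VRC` do not depend on the representative. -/
lemma toWeightedU_mem_VRC {R C : ℕ} {X : PuncturedU k N} (h : toWeightedU d X ∈ VRC k d R C) :
    X.1 * X.1 = 0 ∧ ∀ i j : Fin N, (N ≤ (i : ℕ) + R ∨ (j : ℕ) < C) → X.1 i j = 0 := by
  obtain ⟨Y, ⟨hY, hY0⟩, hYX⟩ := h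
  obtain ⟨c, hc⟩ : ∃ c : kˣ, scale d c Y.1 = X.1 := Quotient.exact hYX
  rw [← hc]
  refine ⟨?_, fun i j hij => ?_⟩
  · ext i j
    rw [scale_mul_scale, hY, Matrix.zero_apply, mul_zero]
  · simp [scale, hY0 i j hij]

end SquareZero

theorem theorem3p5 {k : Type*} [Field k] [IsAlgClosed k] (n r R C : ℕ)
    (hn : 1 ≤ n) (hN : 2 * n < 8) (hr : 1 ≤ r)
    (hR : 1 ≤ R) (hRN : R ≤ 2 * n) (hC : 1 ≤ C) (hCN : C ≤ 2 * n)
    (d : Fin (2 * n) → ℤ) (hd : Antitone d)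
    (ψ : Projectivization k (Fin r → k) →
      ↥(SquareZero.VRC k d R C \ SquareZero.L k d))
    (hψ : SquareZero.IsNonconstantMorphism ψ) :
    2 ^ (r - 1) * (R + C) ≤ 2 * n := by
  obtain ⟨m, hm, P, hhom, -, hrep⟩ := hψ
  set X : Matrix (Fin (2 * n)) (Fin (2 * n)) (MvPolynomial (Fin r) k) :=
    Matrix.of fun i j => if i < j then P i j else 0 with hX
  have hmap : ∀ x, X.map (eval x) = SquareZero.evalUpper P x := by
    intro x
    ext i j
    by_cases h : i < j <;> simp [hX, SquareZero.evalUpper, h]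
  have hpt : ∀ x : Fin r → k, x ≠ 0 → SquareZero.evalUpper P x * SquareZero.evalUpper P x = 0 ∧
      (∀ i j : Fin (2 * n), (2 * n ≤ (i : ℕ) + R ∨ (j : ℕ) < C) →
        SquareZero.evalUpper P x i j = 0) ∧
      n ≤ (SquareZero.evalUpper P x).rank := by
    intro x hx
    obtain ⟨Y, hY, hψY⟩ := hrep x hx
    have hmem := (ψ (Projectivization.mk k x hx)).2
    rw [hψY] at hmem
    obtain ⟨hsq, hzero⟩ := SquareZero.toWeightedU_mem_VRC hmem.1
    rw [hY] at hsq hzero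
    refine ⟨hsq, hzero, ?_⟩
    by_contra! hlt
    exact hmem.2 ⟨Y, ⟨by rw [hY, hsq], by rwa [hY]⟩, rfl⟩
  have hcc : ∀ i j, constantCoeff (X i j) = 0 := by
    intro i j
    by_cases h : i < j
    · have hdeg : ((m : ℤ) * (d i - d j + 1)).toNat ≠ 0 := by
        have : 0 < (m : ℤ) * (d i - d j + 1) :=
          mul_pos (by exact_mod_cast hm) (by linarith [hd h.le])
        omega
      simp only [hX, Matrix.of_apply, h, if_true, constantCoeff_eq]
      exact (hhom i j h).coeff_eq_zero (by simpa using hdeg.symm)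
    · simp [hX, h]
  -- Pointwise identities off the origin become polynomial identities: the constant term handles the
  -- origin, and `k` is infinite.
  have hzero : ∀ p : MvPolynomial (Fin r) k, constantCoeff p = 0 →
      (∀ x : Fin r → k, x ≠ 0 → eval x p = 0) → p = 0 := by
    intro p hp hpx
    refine MvPolynomial.funext fun x => ?_
    rw [map_zero]
    by_cases hx : x = 0
    · rw [hx, ← hp, constantCoeff_eq, ← constantCoeff_eq, eval_zero]
    · exact hpx x hx
  have hzeroX : ∀ i j : Fin (2 * n), (2 * n ≤ (i : ℕ) + R ∨ (j : ℕ) < C) → X i j = 0 := by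
    intro i j hij
    refine hzero _ (hcc i j) fun x hx => ?_
    have := (hpt x hx).2.1 i j hij
    rwa [← hmap] at this
  have hfam : IsSquareZeroFamily n X :=
    { upper := fun i j hij => by simp [hX, hij.not_gt]
      constantCoeff_eq := hcc
      sq := by
        ext1 i j
        refine hzero _ ?_ fun x hx => ?_
        · simp [Matrix.mul_apply, hcc]
        · have := (hpt x hx).1
          rw [← hmap, ← Matrix.map_mul] at this
          exact congrFun₂ this i j
      rank := fun x hx => by
        rw [hmap]
        exact (hpt x hx).2.2 }
  exact hfam.two_pow_mul_le hn hN hr hR hC (fun i j hi => hzeroX i j (Or.inl hi))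
    fun i j hj => hzeroX i j (Or.inr hj)
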